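/- Let $d\ge 3$, let $\mathbb{S}^{d-1}=\{x\in\mathbb{R}^d:\|x\|=1\}$ carry the rotation-invariant surface measure $\omega_{d-1}$ with total mass $1$, and let $e^d=(0,\dots,0,1)^\top$. For $n\in\mathbb{N}_0$ let $\mathcal{H}_n^d$ be the space of complex spherical harmonics of degree $n$ on $\mathbb{S}^{d-1}$ (restrictions to the sphere of homogeneous harmonic polynomials of degree $n$), and for $N\in\mathbb{N}_0$ let $\Pi_N(\mathbb{S}^{d-1})=\operatorname{span}\bigcup_{n\le N}\mathcal{H}_n^d$ be the space of spherical polynomials of degree at most $N$. For $g\in SO(d)$ let $(T^d(g)f)(\eta)=f(g^{-1}\eta)$, and let $$\mathcal{M}_N^1(SO(d))=\operatorname{span}\Big\{\,g\mapsto\int_{\mathbb{S}^{d-1}}(T^d(g)Y)\,\overline{Z}\,\mathrm{d}\omega_{d-1}\ :\ n\le N,\ Y,Z\in\mathcal{H}_n^d\Big\}$$ be the span of the matrix coefficients of the (class-1) representations of $SO(d)$ on $\mathcal{H}_n^d$, $n\le N$. Identify $SO(d-1)$ with the subgroup $\{h\in SO(d): he^d=e^d\}$, let $\mu_{d-1}$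 be its Haar measure with total mass $1$, and for each $\eta\in\mathbb{S}^{d-1}$ let $g_\eta$ be an arbitrary element of $SO(d)$ with $g_\eta e^d=\eta$. Let $N_1,N_2\in\mathbb{N}_0$, $f_1\in\mathcal{M}_{N_1}^1(SO(d))$ and $f_2\in\mathcal{M}_{N_2}^1(SO(d))$. Then the function $$\eta\mapsto\int_{SO(d-1)}f_1(g_\eta h)\,f_2(g_\eta h)\,\mathrm{d}\mu_{d-1}(h)$$ belongs to $\Pi_{N_1+N_2}(\mathbb{S}^{d-1})$, that is, it is a spherical polynomial of degree at most $N_1+N_2$. -/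

import Mathlib

open MeasureTheory

noncomputable section

namespace RotationPoly

/-- The unit sphere `S^{d-1}` in Euclidean space `ℝ^d`. -/
abbrev Sph (d : ℕ) : Type := Metric.sphere (0 : EuclideanSpace ℝ (Fin d)) 1

/-- The special orthogonal group `SO(d)`, with the topology induced from `ℝ^{d × d}`. -/
abbrev SO (d : ℕ) : Type := Matrix.specialOrthogonalGroup (Fin d) ℝ

/-! ### The action of `SO(d)` on `ℝ^d` and on the sphere -/

/-- The action of `g ∈ SO(d)` on column vectors, `x ↦ g x`. -/
def act {d : ℕ} (g : SO d) (x : EuclideanSpace ℝ (Fin d)) : EuclideanSpace ℝ (Fin d) :=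
  WithLp.toLp 2 (Matrix.mulVec (g : Matrix (Fin d) (Fin d) ℝ) x.ofLp)

theorem transpose_mul_self {d : ℕ} (g : SO d) :
    (g : Matrix (Fin d) (Fin d) ℝ).transpose * (g : Matrix (Fin d) (Fin d) ℝ) = 1 :=
  (Matrix.mem_orthogonalGroup_iff' _ _).1 (Matrix.mem_specialOrthogonalGroup_iff.1 g.2).1

theorem act_mul {d : ℕ} (g h : SO d) (x : EuclideanSpace ℝ (Fin d)) :
    act (g * h) x = act g (act h x) := by
  simp [act, Matrix.mulVec_mulVec]

theorem act_one {d : ℕ} (x : EuclideanSpace ℝ (Fin d)) : act (1 : SO d) x = x := by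
  simp [act]

theorem norm_act {d : ℕ} (g : SO d) (x : EuclideanSpace ℝ (Fin d)) : ‖act g x‖ = ‖x‖ := by
  have h : inner ℝ (act g x) (act g x) = inner ℝ x x := by
    simp only [act, EuclideanSpace.inner_eq_star_dotProduct, star_trivial]
    rw [Matrix.dotProduct_mulVec, Matrix.vecMul_mulVec, transpose_mul_self, Matrix.vecMul_one]
  rw [real_inner_self_eq_norm_sq, real_inner_self_eq_norm_sq] at h
  exact (sq_eq_sq₀ (norm_nonneg _) (norm_nonneg _)).1 h

/-- The action of `g ∈ SO(d)` on the sphere, `η ↦ g η`. -/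
def rot {d : ℕ} (g : SO d) (η : Sph d) : Sph d :=
  ⟨act g η, by simp [norm_act]⟩

/-- The last canonical basis vector `e^d` of `ℝ^d`. -/
def lastVec (d : ℕ) : EuclideanSpace ℝ (Fin d) :=
  WithLp.toLp 2 (fun i => if (i : ℕ) + 1 = d then 1 else 0)

/-- `SO(d-1)`, as the subgroup of those `h ∈ SO(d)` that fix the last basis vector `e^d`. -/
def SOsub (d : ℕ) : Subgroup (SO d) where
  carrier := {h | act h (lastVec d) = lastVec d}
  mul_mem' {a b} ha hb := by
    simp only [Set.mem_ofPred_eq] at *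
    rw [act_mul, hb, ha]
  one_mem' := act_one _
  inv_mem' {a} ha := by
    simp only [Set.mem_ofPred_eq] at *
    conv_lhs => rw [← ha]
    rw [← act_mul, inv_mul_cancel, act_one]

/-! ### The normalized measures -/

/-- The rotation-invariant surface measure on `S^{d-1}`, normalized to total mass one. -/
def sphereMeasure (d : ℕ) : Measure (Sph d) :=
  ((volume : Measure (EuclideanSpace ℝ (Fin d))).toSphere Set.univ)⁻¹ •
    (volume : Measure (EuclideanSpace ℝ (Fin d))).toSphere

theorem coe_inv {d : ℕ} (g : SO d) :
    ((g⁻¹ : SO d) : Matrix (Fin d) (Fin d) ℝ) = (g : Matrix (Fin d) (Fin d) ℝ).transpose := by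
  ext i j
  rfl

instance instTopGroupSO (d : ℕ) : IsTopologicalGroup (SO d) where
  continuous_mul := by
    refine Continuous.subtype_mk ?_ _
    exact (continuous_subtype_val.comp continuous_fst).matrix_mul
      (continuous_subtype_val.comp continuous_snd)
  continuous_inv := by
    refine continuous_induced_rng.2 ?_
    have : (Subtype.val ∘ fun g : SO d => g⁻¹) =
        fun g : SO d => (g : Matrix (Fin d) (Fin d) ℝ).transpose := funext fun g => coe_inv g
    rw [this]
    exact continuous_subtype_val.matrix_transpose

theorem entry_abs_le {d : ℕ} (g : SO d) (i j : Fin d) :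
    (g : Matrix (Fin d) (Fin d) ℝ) i j ∈ Set.Icc (-1 : ℝ) 1 := by
  have h := congrFun (congrFun (transpose_mul_self g) j) j
  rw [Matrix.mul_apply, Matrix.one_apply_eq] at h
  have h1 : (g : Matrix (Fin d) (Fin d) ℝ) i j * (g : Matrix (Fin d) (Fin d) ℝ) i j ≤ 1 := by
    rw [← h]
    exact Finset.single_le_sum
      (f := fun k => (g : Matrix (Fin d) (Fin d) ℝ).transpose j k *
        (g : Matrix (Fin d) (Fin d) ℝ) k j)
      (fun k _ => mul_self_nonneg _) (Finset.mem_univ i)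
  constructor <;> nlinarith

instance instCompactSO (d : ℕ) : CompactSpace (SO d) := by
  refine isCompact_iff_compactSpace.1 ?_
  have hK : @IsCompact (Matrix (Fin d) (Fin d) ℝ) _
      (Set.univ.pi fun _ => Set.univ.pi fun _ => Set.Icc (-1 : ℝ) 1) :=
    isCompact_univ_pi (X := fun _ : Fin d => Fin d → ℝ)
      fun _ => isCompact_univ_pi fun _ => isCompact_Icc
  refine hK.of_isClosed_subset ?_ fun A hA i _ j _ => entry_abs_le ⟨A, hA⟩ i j
  have : ((Matrix.specialOrthogonalGroup (Fin d) ℝ : Submonoid (Matrix (Fin d) (Fin d) ℝ)) :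
      Set (Matrix (Fin d) (Fin d) ℝ)) = {A | A * A.transpose = 1} ∩ {A | A.det = 1} := by
    refine Set.ext fun A => ?_
    rw [SetLike.mem_coe, Matrix.mem_specialOrthogonalGroup_iff, Matrix.mem_orthogonalGroup_iff]
    rfl
  rw [this]
  refine IsClosed.inter (isClosed_eq ?_ continuous_const) (isClosed_eq ?_ continuous_const)
  · exact continuous_id.matrix_mul continuous_id.matrix_transpose
  · exact continuous_id.matrix_det

theorem continuous_act_right {d : ℕ} (x : EuclideanSpace ℝ (Fin d)) :
    Continuous fun g : SO d => act g x :=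
  (PiLp.continuous_toLp 2 _).comp (continuous_subtype_val.matrix_mulVec continuous_const)

instance instCompactSOsub (d : ℕ) : CompactSpace (SOsub d) :=
  isCompact_iff_compactSpace.1
    (IsClosed.isCompact (isClosed_eq (continuous_act_right (lastVec d)) continuous_const))

instance instMeasurableSpaceSOsub (d : ℕ) : MeasurableSpace (SOsub d) := borel _

instance instBorelSpaceSOsub (d : ℕ) : BorelSpace (SOsub d) := ⟨rfl⟩

/-- The Haar measure on `SO(d-1)`, normalized to total mass one. -/
def haarSOsub (d : ℕ) : Measure (SOsub d) := Measure.haarMeasure ⊤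

/-! ### Spherical harmonics, spherical polynomials, class-one matrix coefficients -/

/-- The Laplacian `∑ i, ∂²/∂x_i²` on complex polynomials in `d` variables. -/
def polyLaplacian (d : ℕ) : MvPolynomial (Fin d) ℂ →ₗ[ℂ] MvPolynomial (Fin d) ℂ :=
  ∑ i : Fin d, (MvPolynomial.pderiv i).toLinearMap ∘ₗ (MvPolynomial.pderiv i).toLinearMap

/-- Restriction of a complex polynomial in `d` variables to the sphere `S^{d-1}`. -/
def restrictSph (d : ℕ) : MvPolynomial (Fin d) ℂ →ₗ[ℂ] (Sph d → ℂ) where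
  toFun p := fun η => MvPolynomial.eval (fun i => ((η : EuclideanSpace ℝ (Fin d)) i : ℂ)) p
  map_add' p q := by ext; simp
  map_smul' c p := by ext; simp

/-- The space `H_n^d` of spherical harmonics of degree `n` on `S^{d-1}`: restrictions to the sphere
of harmonic homogeneous polynomials of degree `n` with complex coefficients. -/
def sphericalHarmonics (d n : ℕ) : Submodule ℂ (Sph d → ℂ) :=
  (MvPolynomial.homogeneousSubmodule (Fin d) ℂ n ⊓ LinearMap.ker (polyLaplacian d)).map
    (restrictSph d)

/-- The space `Π_N(S^{d-1})` of spherical polynomials of degree at most `N`: the span of all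
spherical harmonics of degree at most `N`. -/
def sphericalPolys (d N : ℕ) : Submodule ℂ (Sph d → ℂ) :=
  Submodule.span ℂ {Y | ∃ n ≤ N, Y ∈ sphericalHarmonics d n}

/-- The representation `T^d` of `SO(d)` on functions on the sphere, `T^d(g) f (η) = f(g⁻¹ η)`. -/
def rep {d : ℕ} (g : SO d) (f : Sph d → ℂ) : Sph d → ℂ := fun η => f (rot g⁻¹ η)

/-- The inner product `⟨f₁, f₂⟩ = ∫ f₁ conj(f₂) dω` on `S^{d-1}`. -/
def sphInner {d : ℕ} (f₁ f₂ : Sph d → ℂ) : ℂ :=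
  ∫ η, f₁ η * (starRingEnd ℂ) (f₂ η) ∂(sphereMeasure d)

/-- The matrix coefficient `g ↦ ⟨T^d(g) Y, Z⟩` of the representation `T^d`. -/
def matrixCoeff {d : ℕ} (Y Z : Sph d → ℂ) : SO d → ℂ := fun g => sphInner (rep g Y) Z

/-- The space `M_N^1(SO(d))`: the span of the matrix coefficients of the subrepresentations of
`T^d` on the spaces of spherical harmonics of degrees `n ≤ N`. -/
def classOnePolys (d N : ℕ) : Submodule ℂ (SO d → ℂ) :=
  Submodule.span ℂ {t | ∃ n ≤ N, ∃ Y ∈ sphericalHarmonics d n, ∃ Z ∈ sphericalHarmonics d n,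
    t = matrixCoeff Y Z}

end RotationPoly

end

namespace RotationPoly

open MvPolynomial

/-! The proof tests the averaged function `φ` on great circles. Since `g⁻¹ = gᵀ`, a matrix
coefficient built from harmonics of degree `n` is a polynomial of degree at most `n` in the entries
of `g` (`exists_matrixCoeff_eq_eval_entries`), so `f₁ f₂` is a polynomial `P` of degree at most `N₁
+ N₂` in these entries. Averaging over `SO(d-1)` removes the choice of `g_η`. On the great circle of
an orthonormal frame `U`, one may therefore take `g_η = R_v g₀`, with `R_v` the rotation in the
plane of `U` and `v` the frame coordinates of `η`. The entries of `R_v` are affine in `v`, so `φ` is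
a polynomial of degree at most `N₁ + N₂` in `v` (`exists_integral_eval_entries_eq`).

It remains to pass from circles to the sphere (`mem_sphericalPolys_of_polynomial_on_circles`). After
splitting by parity under `η ↦ -η`, each part agrees on every circle with a form of one fixed degree
`M`. Its extension `Φ(x) = ‖x‖^M φ(x/‖x‖)` is then a form of degree `M` on every plane through `0`.
Every affine line lies in such a plane, so `Φ` is polynomial of degree at most `M` in each variable
separately, hence a polynomial, and by scaling a form of degree `M`. Forms restrict to spherical
polynomials by the decomposition into terms `|x|^(2j) h` with `h` harmonic. -/

/-! ### Affine substitution and integration over parameters -/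

theorem totalDegree_aeval_le_of_totalDegree_le_one {ι κ R S : Type*} [CommSemiring R]
    [CommSemiring S] [Algebra R S] (f : ι → MvPolynomial κ S) (hf : ∀ i, (f i).totalDegree ≤ 1)
    (p : MvPolynomial ι R) : (aeval f p).totalDegree ≤ p.totalDegree := by
  rw [aeval_def, eval₂_eq]
  refine totalDegree_finsetSum_le fun m hm => ?_
  refine (totalDegree_mul _ _).trans ?_
  rw [IsScalarTower.algebraMap_apply R S, algebraMap_eq, totalDegree_C, zero_add]
  refine (totalDegree_finsetProd _ _).trans ?_
  refine le_trans (Finset.sum_le_sum fun i _ => ?_) (le_totalDegree hm)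
  refine (totalDegree_pow _ _).trans ?_
  simpa using Nat.mul_le_mul_left (m i) (hf i)

/-- A polynomial evaluated at points depending in an affine way on `z`, with coefficients `w`, is a
polynomial in `z` whose coefficients are polynomials in `w`. -/
theorem exists_eval_affine_eq {ι κ : Type*} [Fintype κ] (p : MvPolynomial ι ℂ) :
    ∃ P : MvPolynomial κ (MvPolynomial (ι × Option κ) ℂ), P.totalDegree ≤ p.totalDegree ∧
      ∀ (z : κ → ℂ) (w : ι × Option κ → ℂ),
        eval (fun i => w (i, none) + ∑ k : κ, z k * w (i, some k)) p =
          ∑ m ∈ P.support, eval z (monomial m 1) * eval w (coeff m P) := by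
  refine ⟨aeval (fun i => C (X (i, none)) + ∑ k : κ, X k * C (X (i, some k))) p,
    totalDegree_aeval_le_of_totalDegree_le_one _ (fun i => ?_) p, fun z w => ?_⟩
  · refine (totalDegree_add _ _).trans (max_le (by simp) ?_)
    refine totalDegree_finsetSum_le fun k _ => (totalDegree_mul _ _).trans ?_
    simp
  · set P : MvPolynomial κ (MvPolynomial (ι × Option κ) ℂ) :=
      aeval (fun i => C (X (i, none)) + ∑ k : κ, X k * C (X (i, some k))) p with hP
    have h1 : eval₂ (eval w) z P =
        eval (fun i => w (i, none) + ∑ k : κ, z k * w (i, some k)) p := by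
      rw [hP, ← coe_eval₂Hom, aeval_def, eval₂_eq, map_sum, eval_eq]
      refine Finset.sum_congr rfl fun m _ => ?_
      rw [map_mul, map_prod]
      simp [IsScalarTower.algebraMap_apply ℂ (MvPolynomial (ι × Option κ) ℂ)
        (MvPolynomial κ (MvPolynomial (ι × Option κ) ℂ)), algebraMap_eq]
    rw [← h1, eval₂_eq]
    refine Finset.sum_congr rfl fun m _ => ?_
    rw [eval_monomial, one_mul, mul_comm]
    rfl

/-- The integral acts only on the coefficients, so the degree in `z` does not grow. Used over the
sphere, with `z` the entries of `g`, and over `SO(d-1)`, with `z` the point of a circle. -/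
theorem exists_integral_eval_affine_eq {ι κ X : Type*} [Fintype κ] [MeasurableSpace X]
    (μ : Measure X) (p : MvPolynomial ι ℂ) (w : X → ι × Option κ → ℂ) (ρ : X → ℂ)
    (hw : ∀ q : MvPolynomial (ι × Option κ) ℂ, Integrable (fun x => eval (w x) q * ρ x) μ) :
    ∃ Q : MvPolynomial κ ℂ, Q.totalDegree ≤ p.totalDegree ∧ ∀ z : κ → ℂ,
      ∫ x, eval (fun i => w x (i, none) + ∑ k, z k * w x (i, some k)) p * ρ x ∂μ = eval z Q := by
  obtain ⟨P, hP, h⟩ := exists_eval_affine_eq (κ := κ) p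
  refine ⟨∑ m ∈ P.support, monomial m (∫ x, eval (w x) (coeff m P) * ρ x ∂μ), ?_, fun z => ?_⟩
  · refine totalDegree_finsetSum_le fun m hm => (totalDegree_monomial_le _ _).trans ?_
    exact (le_totalDegree hm).trans hP
  · simp_rw [h, Finset.sum_mul, mul_assoc]
    rw [integral_finsetSum _ fun m _ => (hw _).const_mul _, map_sum]
    refine Finset.sum_congr rfl fun m _ => ?_
    rw [integral_const_mul, eval_monomial, eval_monomial, one_mul, mul_comm]

/-! ### Separately polynomial functions -/

/-- Lagrange interpolation in one variable at the nodes `0, …, M` writes `f` through its values at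
these nodes, which depend on one variable fewer. The uniform degree bound is what allows the same
nodes for all `x`. -/
theorem exists_mvPolynomial_of_separately_polynomial {d : ℕ} (M : ℕ) (f : (Fin d → ℝ) → ℂ)
    (hf : ∀ x k, ∃ p : Polynomial ℂ, p.natDegree ≤ M ∧
      ∀ t : ℝ, f (Function.update x k t) = p.eval (t : ℂ)) :
    ∃ P : MvPolynomial (Fin d) ℂ, ∀ x, f x = eval (fun i => (x i : ℂ)) P := by
  suffices H : ∀ (s : Finset (Fin d)) (f : (Fin d → ℝ) → ℂ),
      (∀ x k, ∃ p : Polynomial ℂ, p.natDegree ≤ M ∧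
        ∀ t : ℝ, f (Function.update x k t) = p.eval (t : ℂ)) →
      (∀ x y, (∀ i ∈ s, x i = y i) → f x = f y) →
      ∃ P : MvPolynomial (Fin d) ℂ, ∀ x, f x = eval (fun i => (x i : ℂ)) P from
    H Finset.univ f hf fun x y h => congrArg f (funext fun i => h i (Finset.mem_univ i))
  intro s
  induction s using Finset.induction_on with
  | empty =>
    intro f _ h
    exact ⟨C (f 0), fun x => by rw [eval_C]; exact h _ _ (by simp)⟩
  | insert k s _ ih =>
    intro f hf h
    have hinj : Set.InjOn (fun j : ℕ => (j : ℂ)) (Finset.range (M + 1)) :=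
      fun a _ b _ hab => Nat.cast_injective hab
    choose P hP using fun j : ℕ => ih (fun x => f (Function.update x k (j : ℝ)))
      (fun x i => by
        by_cases hik : i = k
        · subst hik
          exact ⟨Polynomial.C (f (Function.update x i j)), by simp, by simp⟩
        · obtain ⟨p, hp, hp'⟩ := hf (Function.update x k j) i
          exact ⟨p, hp, fun t => by rw [Function.update_comm hik, hp']⟩)
      (fun x y hxy => h _ _ fun i hi => by
        by_cases hik : i = k
        · subst hik; simp
        · simp [hik, hxy i (Finset.mem_of_mem_insert_of_ne hi hik)])
    refine ⟨∑ j ∈ Finset.range (M + 1), P j *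
      Polynomial.aeval (X k) (Lagrange.basis (Finset.range (M + 1)) (fun j : ℕ => (j : ℂ)) j),
      fun x => ?_⟩
    obtain ⟨p, hp, hp'⟩ := hf x k
    have h1 := hp' (x k)
    rw [Function.update_eq_self] at h1
    rw [h1, Lagrange.eq_interpolate hinj
      (show p.degree < _ from (Polynomial.degree_le_of_natDegree_le hp).trans_lt (by
        simp only [Finset.card_range]; exact_mod_cast Nat.lt_succ_self M)),
      Lagrange.interpolate_apply, Polynomial.eval_finsetSum, map_sum]
    refine Finset.sum_congr rfl fun j _ => ?_
    rw [map_mul, ← hP, hp', Polynomial.eval_mul, Polynomial.eval_C]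
    congr 1
    rw [← coe_aeval_eq_eval, RingHom.coe_coe, ← Polynomial.aeval_algHom_apply]
    simp [Polynomial.aeval_def]

/-! ### Harmonic decomposition of homogeneous polynomials -/

/-- The polynomial `∑ i, x_i²`. -/
noncomputable def normSqPoly (d : ℕ) : MvPolynomial (Fin d) ℂ := ∑ i, X i ^ 2

theorem isHomogeneous_normSqPoly (d : ℕ) : (normSqPoly d).IsHomogeneous 2 :=
  IsHomogeneous.sum _ _ _ fun i _ => isHomogeneous_X_pow i 2

theorem polyLaplacian_apply {d : ℕ} (p : MvPolynomial (Fin d) ℂ) :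
    polyLaplacian d p = ∑ i, pderiv i (pderiv i p) := by
  simp [polyLaplacian]

theorem pderiv_normSqPoly {d : ℕ} (i : Fin d) : pderiv i (normSqPoly d) = 2 * X i := by
  rw [normSqPoly, map_sum, Finset.sum_eq_single i]
  · simp [Derivation.leibniz_pow]
  · intro j _ hj
    simp [Derivation.leibniz_pow, pderiv_X_of_ne hj]
  · simp

/-- Leibniz rule: the cross terms give `4m` by Euler's identity, and the Laplacian of `|x|²` gives
`2d`. -/
theorem polyLaplacian_normSqPoly_mul {d m : ℕ} {p : MvPolynomial (Fin d) ℂ}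
    (hp : p.IsHomogeneous m) :
    polyLaplacian d (normSqPoly d * p) =
      normSqPoly d * polyLaplacian d p + (4 * m + 2 * d : ℕ) • p := by
  have h : ∀ i, pderiv i (pderiv i (normSqPoly d * p)) =
      normSqPoly d * pderiv i (pderiv i p) + (4 * (X i * pderiv i p) + 2 * p) := fun i => by
    have h2 : pderiv i (2 : MvPolynomial (Fin d) ℂ) = 0 := 
      pderiv_C (R := ℂ) (i := i) (a := 2)
    simp only [pderiv_mul, map_add, pderiv_normSqPoly, pderiv_X_self, h2]
    ring
  rw [polyLaplacian_apply, polyLaplacian_apply, Finset.sum_congr rfl fun i _ => h i,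
    Finset.sum_add_distrib, Finset.sum_add_distrib, ← Finset.mul_sum, ← Finset.mul_sum,
    hp.sum_X_mul_pderiv]
  simp only [nsmul_eq_mul, Finset.sum_const, Finset.card_univ, Fintype.card_fin]
  push_cast
  ring

theorem polyLaplacian_normSqPoly_pow_mul {d k : ℕ} (hd : 0 < d) {h : MvPolynomial (Fin d) ℂ}
    (hh : h.IsHomogeneous k) (hΔ : polyLaplacian d h = 0) (j : ℕ) :
    ∃ c : ℕ, 0 < c ∧ polyLaplacian d (normSqPoly d ^ (j + 1) * h) = c • (normSqPoly d ^ j * h) := by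
  induction j with
  | zero =>
    refine ⟨4 * k + 2 * d, by omega, ?_⟩
    rw [zero_add, pow_one, polyLaplacian_normSqPoly_mul hh, hΔ]
    simp
  | succ j ih =>
    obtain ⟨c, _, hc⟩ := ih
    refine ⟨c + (4 * (2 * (j + 1) + k) + 2 * d), by omega, ?_⟩
    rw [pow_succ' _ (j + 1), mul_assoc,
      polyLaplacian_normSqPoly_mul (((isHomogeneous_normSqPoly d).pow (j + 1)).mul hh), hc]
    rw [mul_smul_comm, ← mul_assoc (normSqPoly d), ← pow_succ', ← add_smul]

theorem isHomogeneous_polyLaplacian {d n : ℕ} {p : MvPolynomial (Fin d) ℂ}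
    (hp : p.IsHomogeneous (n + 2)) : (polyLaplacian d p).IsHomogeneous n := by
  rw [polyLaplacian_apply]
  exact IsHomogeneous.sum _ _ _ fun i _ => hp.pderiv.pderiv

theorem polyLaplacian_eq_zero_of_isHomogeneous {d n : ℕ} (hn : n < 2) {p : MvPolynomial (Fin d) ℂ}
    (hp : p.IsHomogeneous n) : polyLaplacian d p = 0 := by
  rw [polyLaplacian_apply]
  refine Finset.sum_eq_zero fun i _ => ?_
  have h : (pderiv i p).IsHomogeneous 0 := by
    have := hp.pderiv (i := i)
    rwa [show n - 1 = 0 by omega] at this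
  rw [totalDegree_eq_zero_iff_eq_C.1 ((totalDegree_zero_iff_isHomogeneous _).2 h), pderiv_C]

/-- The span of the products `|x|^(2j) h` of degree `n` with `h` homogeneous and harmonic. -/
noncomputable def normSqMulHarmonic (d n : ℕ) : Submodule ℂ (MvPolynomial (Fin d) ℂ) :=
  Submodule.span ℂ {p | ∃ j k h, 2 * j + k = n ∧ h.IsHomogeneous k ∧ polyLaplacian d h = 0 ∧
    p = normSqPoly d ^ j * h}

theorem normSqMulHarmonic_le (d n : ℕ) :
    normSqMulHarmonic d n ≤ homogeneousSubmodule (Fin d) ℂ n := by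
  refine Submodule.span_le.2 ?_
  rintro _ ⟨j, k, h, rfl, hh, -, rfl⟩
  exact ((isHomogeneous_normSqPoly d).pow j).mul hh

/-- On a generator, the preimage is the same term times `|x|²`, divided by the nonzero constant that
the Laplacian produces. -/
theorem exists_polyLaplacian_eq {d n : ℕ} (hd : 0 < d) {q : MvPolynomial (Fin d) ℂ}
    (hq : q ∈ normSqMulHarmonic d n) :
    ∃ r ∈ normSqMulHarmonic d (n + 2), polyLaplacian d r = q := by
  induction hq using Submodule.span_induction with
  | mem x hx =>
    obtain ⟨j, k, h, rfl, hh, hΔ, rfl⟩ := hx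
    obtain ⟨c, hc, hc'⟩ := polyLaplacian_normSqPoly_pow_mul hd hh hΔ j
    refine ⟨(c : ℂ)⁻¹ • (normSqPoly d ^ (j + 1) * h), Submodule.smul_mem _ _
      (Submodule.subset_span ⟨j + 1, k, h, by ring, hh, hΔ, rfl⟩), ?_⟩
    rw [map_smul, hc', ← Nat.cast_smul_eq_nsmul ℂ, inv_smul_smul₀]
    exact_mod_cast hc.ne'
  | zero => exact ⟨0, zero_mem _, map_zero _⟩
  | add x y _ _ hx hy =>
    obtain ⟨r, hr, rfl⟩ := hx
    obtain ⟨s, hs, rfl⟩ := hy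
    exact ⟨r + s, add_mem hr hs, map_add _ _ _⟩
  | smul a x _ hx =>
    obtain ⟨r, hr, rfl⟩ := hx
    exact ⟨a • r, Submodule.smul_mem _ _ hr, map_smul _ _ _⟩

/-- By induction `Δp` lies in the span two degrees lower, so some `r` in the span has `Δr = Δp`, and
`p - r` is harmonic. -/
theorem isHomogeneous_mem_normSqMulHarmonic {d : ℕ} (hd : 0 < d) (n : ℕ)
    {p : MvPolynomial (Fin d) ℂ} (hp : p.IsHomogeneous n) : p ∈ normSqMulHarmonic d n := by
  induction n using Nat.strong_induction_on generalizing p with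
  | _ n ih =>
    have harm : ∀ {q}, q.IsHomogeneous n → polyLaplacian d q = 0 → q ∈ normSqMulHarmonic d n :=
      fun {q} hq hΔ => Submodule.subset_span ⟨0, n, q, by ring, hq, hΔ, by simp⟩
    rcases lt_or_ge n 2 with hn | hn
    · exact harm hp (polyLaplacian_eq_zero_of_isHomogeneous hn hp)
    · obtain ⟨m, rfl⟩ := Nat.exists_eq_add_of_le' hn
      obtain ⟨r, hr, hr'⟩ := exists_polyLaplacian_eq hd
        (ih m (by omega) (isHomogeneous_polyLaplacian hp))
      have := harm (hp.sub (normSqMulHarmonic_le d _ hr)) (by rw [map_sub, hr', sub_self])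
      simpa using add_mem this hr

theorem eval_normSqPoly {d : ℕ} (η : Sph d) :
    eval (fun i => ((η : EuclideanSpace ℝ (Fin d)) i : ℂ)) (normSqPoly d) = 1 := by
  have h : ‖(η : EuclideanSpace ℝ (Fin d))‖ ^ 2 = 1 := by simp
  rw [EuclideanSpace.real_norm_sq_eq] at h
  rw [normSqPoly, map_sum]
  simp only [map_pow, eval_X]
  exact_mod_cast h

theorem sphericalPolys_mono {d m n : ℕ} (h : m ≤ n) : sphericalPolys d m ≤ sphericalPolys d n :=
  Submodule.span_mono fun _ ⟨k, hk, hY⟩ => ⟨k, hk.trans h, hY⟩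

theorem restrictSph_mem_sphericalPolys {d : ℕ} (hd : 0 < d) {n : ℕ} {p : MvPolynomial (Fin d) ℂ}
    (hp : p.IsHomogeneous n) : restrictSph d p ∈ sphericalPolys d n := by
  have h : normSqMulHarmonic d n ≤ (sphericalPolys d n).comap (restrictSph d) := by
    refine Submodule.span_le.2 ?_
    rintro _ ⟨j, k, h, rfl, hh, hΔ, rfl⟩
    refine Submodule.subset_span ⟨k, by omega, h, ⟨hh, hΔ⟩, ?_⟩
    funext η
    simp [restrictSph, eval_normSqPoly]
  exact h (isHomogeneous_mem_normSqMulHarmonic hd n hp)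

/-! ### Parity and homogenization on the unit circle -/

theorem eval_smul_of_isHomogeneous {ι R : Type*} [CommSemiring R] {n : ℕ} {p : MvPolynomial ι R}
    (hp : p.IsHomogeneous n) (c : R) (v : ι → R) : eval (c • v) p = c ^ n * eval v p := by
  rw [eval_eq, eval_eq, Finset.mul_sum]
  refine Finset.sum_congr rfl fun m hm => ?_
  have h : ∑ i ∈ m.support, m i = n := (hp.degree_eq_sum_deg_support hm).symm
  simp only [Pi.smul_apply, smul_eq_mul, mul_pow, Finset.prod_mul_distrib]
  rw [Finset.prod_pow_eq_pow_sum, h]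
  ring

/-- Only components of degree congruent to `M` mod 2 survive the symmetrization, and powers of `X 0
^ 2 + X 1 ^ 2`, equal to `1` on the circle, raise them to degree `M`. Degree `M + 1` is allowed for
`Q` because its top component has the wrong parity. -/
theorem exists_isHomogeneous_eval_eq {M : ℕ} (Q : MvPolynomial (Fin 2) ℂ)
    (hQ : Q.totalDegree ≤ M + 1) :
    ∃ H : MvPolynomial (Fin 2) ℂ, H.IsHomogeneous M ∧ ∀ v : Fin 2 → ℂ, v 0 ^ 2 + v 1 ^ 2 = 1 →
      eval v H = 2⁻¹ * (eval v Q + (-1) ^ M * eval (-v) Q) := by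
  refine ⟨∑ k ∈ Finset.range (M + 1), if Even (M - k) then
    (X 0 ^ 2 + X 1 ^ 2) ^ ((M - k) / 2) * homogeneousComponent k Q else 0,
    IsHomogeneous.sum _ _ _ fun k hk => ?_, fun v hv => ?_⟩
  · split_ifs with h
    · have h1 : (X 0 ^ 2 + X 1 ^ 2 : MvPolynomial (Fin 2) ℂ).IsHomogeneous 2 :=
        (isHomogeneous_X_pow _ _).add (isHomogeneous_X_pow _ _)
      convert (h1.pow ((M - k) / 2)).mul (homogeneousComponent_isHomogeneous k Q) using 1
      have := Nat.two_mul_div_two_of_even h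
      have := Finset.mem_range.1 hk
      omega
    · exact isHomogeneous_zero _ _ _
  · have hsum : Q = ∑ k ∈ Finset.range (M + 2), homogeneousComponent k Q := by
      conv_lhs => rw [← sum_homogeneousComponent Q]
      refine Finset.sum_subset (Finset.range_subset_range.2 (by omega)) fun k _ hk => ?_
      exact homogeneousComponent_eq_zero _ _ (by simpa using hk)
    have hneg : ∀ k, eval (-v) (homogeneousComponent k Q) =
        (-1) ^ k * eval v (homogeneousComponent k Q) := fun k => by
      rw [← eval_smul_of_isHomogeneous (homogeneousComponent_isHomogeneous k Q), neg_one_smul]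
    conv_rhs => rw [hsum]
    rw [map_sum, map_sum, map_sum, Finset.mul_sum, ← Finset.sum_add_distrib, Finset.mul_sum,
      Finset.sum_range_succ _ (M + 1)]
    have hlast : 2⁻¹ * (eval v (homogeneousComponent (M + 1) Q) +
        (-1) ^ M * eval (-v) (homogeneousComponent (M + 1) Q)) = 0 := by
      rw [hneg, ← mul_assoc, ← pow_add, Odd.neg_one_pow ⟨M, by ring⟩]
      ring
    rw [hlast, add_zero]
    refine Finset.sum_congr rfl fun k hk => ?_
    have hk' := Finset.mem_range.1 hk
    obtain ⟨r, rfl⟩ := Nat.exists_eq_add_of_le (Nat.lt_succ_iff.1 hk')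
    rw [hneg, ← mul_assoc, ← pow_add, Nat.add_sub_cancel_left,
      show k + r + k = 2 * k + r by ring, pow_add, pow_mul]
    split_ifs with h
    · simp only [map_mul, map_pow, map_add, eval_X, hv, one_pow, h.neg_one_pow]
      norm_num
      ring
    · rw [(Nat.not_even_iff_odd.1 h).neg_one_pow]
      simp

/-! ### From great circles to the sphere -/

/-- The point of `ℝ^d` with coordinates `v` in the frame given by the columns of `U`. -/
noncomputable def framePoint {d : ℕ} (U : Matrix (Fin d) (Fin 2) ℝ) (v : Fin 2 → ℝ) :
    EuclideanSpace ℝ (Fin d) :=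
  WithLp.toLp 2 (U.mulVec v)

theorem framePoint_smul {d : ℕ} (U : Matrix (Fin d) (Fin 2) ℝ) (c : ℝ) (v : Fin 2 → ℝ) :
    framePoint U (c • v) = c • framePoint U v := by
  simp [framePoint, Matrix.mulVec_smul]

theorem framePoint_add {d : ℕ} (U : Matrix (Fin d) (Fin 2) ℝ) (v w : Fin 2 → ℝ) :
    framePoint U (v + w) = framePoint U v + framePoint U w := by
  simp [framePoint, Matrix.mulVec_add]

theorem norm_framePoint_sq {d : ℕ} {U : Matrix (Fin d) (Fin 2) ℝ} (hU : U.transpose * U = 1)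
    (v : Fin 2 → ℝ) : ‖framePoint U v‖ ^ 2 = v 0 ^ 2 + v 1 ^ 2 := by
  rw [← real_inner_self_eq_norm_sq]
  simp only [framePoint, EuclideanSpace.inner_eq_star_dotProduct, star_trivial]
  rw [Matrix.dotProduct_mulVec, Matrix.vecMul_mulVec, hU, Matrix.vecMul_one]
  simp [dotProduct, Fin.sum_univ_two, sq]

theorem exists_frame {d : ℕ} (hd : 2 ≤ d) (a b : EuclideanSpace ℝ (Fin d)) :
    ∃ U : Matrix (Fin d) (Fin 2) ℝ, U.transpose * U = 1 ∧
      ∃ α β : Fin 2 → ℝ, a = framePoint U α ∧ b = framePoint U β := by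
  let k : Fin 2 → Fin d := Fin.castLE hd
  -- Gram–Schmidt makes every basis vector of index above `1` orthogonal to `f (k 0) = a` and `f (k
  -- 1) = b`, even when these are dependent; the other values of `f` are irrelevant.
  let f : Fin d → EuclideanSpace ℝ (Fin d) := fun i => if i = k 0 then a else b
  have hcard : Module.finrank ℝ (EuclideanSpace ℝ (Fin d)) = Fintype.card (Fin d) := by simp
  let B := InnerProductSpace.gramSchmidtOrthonormalBasis hcard f
  let U : Matrix (Fin d) (Fin 2) ℝ := Matrix.of fun i j => B (k j) i
  have hk : Function.Injective k := Fin.castLE_injective hd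
  have key : ∀ x : EuclideanSpace ℝ (Fin d), (∀ i, (∀ j, i ≠ k j) → inner ℝ (B i) x = 0) →
      x = framePoint U fun j => inner ℝ (B (k j)) x := fun x hx => by
    conv_lhs => rw [← B.sum_repr' x]
    rw [← Finset.sum_subset (Finset.subset_univ (Finset.univ.image k))
      fun i _ hi => by
        rw [hx i fun j hj => hi (Finset.mem_image.2 ⟨j, Finset.mem_univ _, hj.symm⟩), zero_smul],
      Finset.sum_image fun _ _ _ _ h => hk h]
    ext i
    simp [framePoint, Matrix.mulVec, dotProduct, U, mul_comm]
  have hval : ∀ i, (∀ j, i ≠ k j) → 1 < (i : ℕ) := fun i hi => by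
    by_contra h
    exact hi ⟨i, by omega⟩ (Fin.ext rfl)
  refine ⟨U, ?_, _, _, key a fun i hi => ?_, key b fun i hi => ?_⟩
  · ext i j
    have := orthonormal_iff_ite.1 B.orthonormal (k i) (k j)
    simp only [hk.eq_iff] at this
    rw [Matrix.one_apply, ← this]
    simp [Matrix.mul_apply, U, PiLp.inner_apply, mul_comm]
  · have h := InnerProductSpace.gramSchmidtOrthonormalBasis_inv_triangular hcard f
      (i := k 0) (j := i) (Nat.lt_trans Nat.zero_lt_one (hval i hi))
    rwa [show f (k 0) = a from if_pos rfl] at h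
  · have h := InnerProductSpace.gramSchmidtOrthonormalBasis_inv_triangular hcard f
      (i := k 1) (j := i) (hval i hi)
    rwa [show f (k 1) = b from if_neg fun h => absurd (hk h) (by simp)] at h

theorem mem_sphericalPolys_of_homogeneous_on_planes {d M : ℕ} (hd : 2 ≤ d) (φ : Sph d → ℂ)
    (hφ : ∀ U : Matrix (Fin d) (Fin 2) ℝ, U.transpose * U = 1 →
      ∃ H : MvPolynomial (Fin 2) ℂ, H.IsHomogeneous M ∧ ∀ (v : Fin 2 → ℝ) (η : Sph d),
        (η : EuclideanSpace ℝ (Fin d)) = framePoint U v → φ η = eval (fun i => (v i : ℂ)) H) :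
    φ ∈ sphericalPolys d M := by
  -- For `M = 0` the factor `‖x‖ ^ M` does not vanish at the origin; instead, any two points share a
  -- great circle, so `φ` is constant.
  rcases Nat.eq_zero_or_pos M with rfl | hM
  · have hconst : ∀ η ζ, φ η = φ ζ := fun η ζ => by
      obtain ⟨U, hU, α, β, hα, hβ⟩ := exists_frame hd (η : EuclideanSpace ℝ (Fin d)) ζ
      obtain ⟨H, hH, h⟩ := hφ U hU
      rw [h α η hα, h β ζ hβ,
        totalDegree_eq_zero_iff_eq_C.1 ((totalDegree_zero_iff_isHomogeneous _).2 hH), eval_C,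
        eval_C]
    rcases isEmpty_or_nonempty (Sph d) with he | ⟨⟨ζ⟩⟩
    · rw [show φ = 0 from funext fun η => he.elim η]
      exact zero_mem _
    · convert restrictSph_mem_sphericalPolys (d := d) (by omega) (isHomogeneous_C _ (φ ζ))
      funext η
      simp [restrictSph, hconst η ζ]
  have hσ : ∀ u : EuclideanSpace ℝ (Fin d), ∃ η : Sph d,
      u = ‖u‖ • (η : EuclideanSpace ℝ (Fin d)) := fun u => by
    rcases eq_or_ne u 0 with rfl | hu
    · exact ⟨⟨EuclideanSpace.single ⟨0, by omega⟩ 1, by simp⟩, by simp⟩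
    · exact ⟨⟨‖u‖⁻¹ • u, by simp [norm_smul, hu]⟩, by simp [smul_smul, hu]⟩
  choose σ hσ using hσ
  let Φ : (Fin d → ℝ) → ℂ := fun x => (‖WithLp.toLp 2 x‖ : ℂ) ^ M * φ (σ (WithLp.toLp 2 x))
  have hΦ : ∀ U : Matrix (Fin d) (Fin 2) ℝ, U.transpose * U = 1 →
      ∃ H : MvPolynomial (Fin 2) ℂ, H.IsHomogeneous M ∧
        ∀ v x, WithLp.toLp 2 x = framePoint U v → Φ x = eval (fun i => (v i : ℂ)) H := by
    intro U hU
    obtain ⟨H, hH, h⟩ := hφ U hU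
    refine ⟨H, hH, fun v x hx => ?_⟩
    simp only [Φ]
    set u : EuclideanSpace ℝ (Fin d) := WithLp.toLp 2 x
    rcases eq_or_ne u 0 with hu | hu
    · have hn := norm_framePoint_sq hU v
      rw [← hx, hu, norm_zero] at hn
      have h0 : (fun i => (v i : ℂ)) = (0 : ℂ) • (fun i => (v i : ℂ)) := by
        have h0 : v 0 = 0 := by nlinarith
        have h1 : v 1 = 0 := by nlinarith
        ext i
        fin_cases i <;> simp [h0, h1]
      rw [h0, eval_smul_of_isHomogeneous hH, hu]
      simp [hM.ne']
    · have hr : ‖u‖ ≠ 0 := norm_ne_zero_iff.2 hu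
      have h1 : (σ u : EuclideanSpace ℝ (Fin d)) = framePoint U (‖u‖⁻¹ • v) := by
        rw [framePoint_smul, ← hx]
        conv_rhs => rw [hσ u]
        simp [smul_smul, hr, norm_smul]
      have h2 : (fun i => (((‖u‖⁻¹ • v) i : ℝ) : ℂ)) = (‖u‖ : ℂ)⁻¹ • fun i => (v i : ℂ) := by
        ext i; simp
      rw [h _ _ h1, h2, eval_smul_of_isHomogeneous hH, ← mul_assoc, ← mul_pow,
        mul_inv_cancel₀ (by exact_mod_cast hr), one_pow, one_mul]
  obtain ⟨P, hP⟩ := exists_mvPolynomial_of_separately_polynomial M Φ fun x k => by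
    -- The line in direction `k` through `x` lies in a plane through the origin containing its point
    -- with `k`-th coordinate `0` and the basis vector `k`.
    obtain ⟨U, hU, α, β, hα, hβ⟩ := exists_frame hd (WithLp.toLp 2 (Function.update x k 0))
      (EuclideanSpace.single k 1)
    obtain ⟨H, hH, h⟩ := hΦ U hU
    refine ⟨aeval (fun i => Polynomial.C (α i : ℂ) + Polynomial.C (β i : ℂ) * Polynomial.X) H,
      ?_, fun t => ?_⟩
    · refine (aeval_natDegree_le H hH.totalDegree_le _ (n := 1) fun i => ?_).trans (by simp)
      compute_degree
    · rw [h (α + t • β), ← Polynomial.coe_aeval_eq_eval, ← AlgHom.comp_apply,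
        comp_aeval, ← coe_aeval_eq_eval, RingHom.coe_coe]
      · simp [mul_comm (t : ℂ)]
      · rw [framePoint_add, framePoint_smul, ← hα, ← hβ]
        ext i
        by_cases hik : i = k
        · subst hik; simp
        · simp [hik]
  -- Compare the coefficients of `t ^ M` in `P(t x) = t ^ M Φ(x)`, valid for all real `t`.
  have hhom : ∀ x, Φ x = eval (fun i => (x i : ℂ)) (homogeneousComponent M P) := fun x => by
    have hpoly : ∑ n ∈ Finset.range (P.totalDegree + 1),
        Polynomial.C (eval (fun i => (x i : ℂ)) (homogeneousComponent n P)) * Polynomial.X ^ n =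
        Polynomial.C (Φ x) * Polynomial.X ^ M := by
      refine Polynomial.eq_of_infinite_eval_eq _ _
        ((Set.infinite_range_of_injective Complex.ofReal_injective).mono ?_)
      rintro _ ⟨t, rfl⟩
      obtain ⟨U, hU, α, -, hα, -⟩ := exists_frame hd (WithLp.toLp 2 x) 0
      obtain ⟨H, hH, h⟩ := hΦ U hU
      have ht : Φ (t • x) = (t : ℂ) ^ M * Φ x := by
        rw [h α x hα, h (t • α) (t • x) (by rw [framePoint_smul, ← hα]; rfl),
          ← eval_smul_of_isHomogeneous hH]
        congr 2; ext i; simp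
      have hx : (fun i => (((t • x) i : ℝ) : ℂ)) = (t : ℂ) • fun i => (x i : ℂ) := by
        ext i; simp
      rw [hP (t • x), hx, ← sum_homogeneousComponent P, map_sum] at ht
      simp only [eval_smul_of_isHomogeneous (homogeneousComponent_isHomogeneous _ P)] at ht
      simp only [Set.mem_ofPred_eq, Polynomial.eval_finsetSum, Polynomial.eval_mul,
        Polynomial.eval_C, Polynomial.eval_pow, Polynomial.eval_X]
      rw [mul_comm (Φ x), ← ht]
      exact Finset.sum_congr rfl fun n _ => mul_comm _ _
    have hc := congrArg (fun q => Polynomial.coeff q M) hpoly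
    simp only [Polynomial.finsetSum_coeff, Polynomial.coeff_C_mul_X_pow, if_true] at hc
    rw [← hc, Finset.sum_ite_eq]
    split_ifs with hM
    · rfl
    · rw [homogeneousComponent_eq_zero _ _ (by simpa using hM), map_zero]
  convert restrictSph_mem_sphericalPolys (d := d) (by omega)
    (homogeneousComponent_isHomogeneous M P)
  funext η
  have h1 := hσ (η : EuclideanSpace ℝ (Fin d))
  have h2 : ‖(η : EuclideanSpace ℝ (Fin d))‖ = 1 := by simp
  rw [h2, one_smul] at h1
  have h3 : Φ (η : EuclideanSpace ℝ (Fin d)).ofLp = φ η := by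
    simp only [Φ, WithLp.toLp_ofLp, h2]
    rw [← Subtype.ext h1]
    simp
  rw [← h3, hhom]
  rfl

theorem mem_sphericalPolys_of_polynomial_on_circles {d N : ℕ} (hd : 2 ≤ d) (φ : Sph d → ℂ)
    (hφ : ∀ U : Matrix (Fin d) (Fin 2) ℝ, U.transpose * U = 1 →
      ∃ Q : MvPolynomial (Fin 2) ℂ, Q.totalDegree ≤ N ∧ ∀ (v : Fin 2 → ℝ) (η : Sph d),
        (η : EuclideanSpace ℝ (Fin d)) = framePoint U v → φ η = eval (fun i => (v i : ℂ)) Q) :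
    φ ∈ sphericalPolys d N := by
  have key : ∀ M, N ≤ M + 1 →
      (fun η => 2⁻¹ * (φ η + (-1) ^ M * φ (-η))) ∈ sphericalPolys d M := fun M hM => by
    refine mem_sphericalPolys_of_homogeneous_on_planes hd _ fun U hU => ?_
    obtain ⟨Q, hQ, h⟩ := hφ U hU
    obtain ⟨H, hH, hH'⟩ := exists_isHomogeneous_eval_eq Q (hQ.trans hM)
    refine ⟨H, hH, fun v η hη => ?_⟩
    have hn := norm_framePoint_sq hU v
    rw [← hη, norm_eq_of_mem_sphere, one_pow] at hn
    have hv : (fun i => (((-v) i : ℝ) : ℂ)) = -fun i => (v i : ℂ) := by ext i; simp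
    rw [hH' _ (by exact_mod_cast hn.symm), h v η hη, h (-v) (-η) (by
      rw [← neg_one_smul ℝ v, framePoint_smul, ← hη]; simp), hv]
  rcases N with _ | M
  -- In degree `0` the function is constant on each circle, hence even, so the even part is all of
  -- it.
  · convert key 0 (by omega) using 1
    funext η
    obtain ⟨U, hU, α, -, hα, -⟩ := exists_frame hd (η : EuclideanSpace ℝ (Fin d)) 0
    obtain ⟨Q, hQ, h⟩ := hφ U hU
    have hα' : ((-η : Sph d) : EuclideanSpace ℝ (Fin d)) = framePoint U (-α) := by
      rw [← neg_one_smul ℝ α, framePoint_smul, ← hα]; simp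
    rw [h _ _ hα', h _ _ hα, totalDegree_eq_zero_iff_eq_C.1 (Nat.le_zero.1 hQ), eval_C, eval_C]
    ring
  -- The instances `M + 1 = N` and `M = N - 1` are the two parity parts, and they sum to `φ`.
  · convert add_mem (key (M + 1) (by omega))
      (sphericalPolys_mono (Nat.le_succ M) (key M le_rfl)) using 1
    funext η
    simp only [Pi.add_apply, pow_succ]
    ring

/-! ### Matrix coefficients as polynomials in the matrix entries -/

/-- The matrix entries of `g ∈ SO(d)`, as complex numbers. -/
noncomputable def entries {d : ℕ} (g : SO d) : Fin d × Fin d → ℂ :=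
  fun ij => ((g : Matrix (Fin d) (Fin d) ℝ) ij.1 ij.2 : ℂ)

theorem exists_matrixCoeff_eq_eval_entries {d n : ℕ} {Y Z : Sph d → ℂ}
    (hY : Y ∈ sphericalHarmonics d n)
    (hZ : Z ∈ sphericalHarmonics d n) :
    ∃ P : MvPolynomial (Fin d × Fin d) ℂ, P.totalDegree ≤ n ∧
      ∀ g, matrixCoeff Y Z g = eval (entries g) P := by
  obtain ⟨p, ⟨hp, -⟩, rfl⟩ := hY
  obtain ⟨q, -, rfl⟩ := hZ
  -- Coefficients of `(gᵀ η) i = ∑ j, g j i * η j` as a linear form in the entries of `g`; the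
  -- constant term is `0`.
  let w : Sph d → Fin d × Option (Fin d × Fin d) → ℂ := fun η ik =>
    ik.2.elim 0 fun jl => if jl.2 = ik.1 then ((η : EuclideanSpace ℝ (Fin d)) jl.1 : ℂ) else 0
  have hcoord : ∀ j, Continuous fun η : Sph d => ((η : EuclideanSpace ℝ (Fin d)) j : ℂ) :=
    fun j => by fun_prop
  have hw : ∀ ik, Continuous fun η => w η ik := by
    rintro ⟨i, _ | ⟨j, l⟩⟩
    · exact continuous_const
    · simp only [w, Option.elim_some]
      split_ifs
      · exact hcoord j
      · exact continuous_const
  have hZ : Continuous fun η => (starRingEnd ℂ) (restrictSph d q η) :=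
    Complex.continuous_conj.comp
      ((MvPolynomial.continuous_eval q).comp (continuous_pi hcoord))
  obtain ⟨Q, hQ, h⟩ := exists_integral_eval_affine_eq
    (volume : Measure (EuclideanSpace ℝ (Fin d))).toSphere p w
    (fun η => (starRingEnd ℂ) (restrictSph d q η)) fun r =>
      (((MvPolynomial.continuous_eval r).comp (continuous_pi hw)).mul
        hZ).integrable_of_hasCompactSupport (HasCompactSupport.of_compactSpace _)
  refine ⟨C ((((volume : Measure (EuclideanSpace ℝ (Fin d))).toSphere Set.univ)⁻¹.toReal : ℝ) : ℂ)
    * Q, (totalDegree_mul _ _).trans ?_, fun g => ?_⟩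
  · rw [totalDegree_C, zero_add]
    exact hQ.trans (IsHomogeneous.totalDegree_le hp)
  · rw [matrixCoeff, sphInner, sphereMeasure, integral_smul_measure, map_mul, eval_C, ← h,
      Complex.real_smul]
    congr 2
    funext η
    congr 1
    simp only [rep, restrictSph, LinearMap.coe_mk, AddHom.coe_mk]
    congr 2
    funext i
    simp [rot, act, coe_inv, w, entries, Fintype.sum_prod_type, Matrix.mulVec, dotProduct]

theorem exists_eval_entries_of_mem_classOnePolys {d N : ℕ} {f : SO d → ℂ}
    (hf : f ∈ classOnePolys d N) :
    ∃ P : MvPolynomial (Fin d × Fin d) ℂ, P.totalDegree ≤ N ∧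
      ∀ g, f g = eval (entries g) P := by
  induction hf using Submodule.span_induction with
  | mem f hf =>
    obtain ⟨n, hn, Y, hY, Z, hZ, rfl⟩ := hf
    obtain ⟨P, hP, h⟩ := exists_matrixCoeff_eq_eval_entries hY hZ
    exact ⟨P, hP.trans hn, h⟩
  | zero => exact ⟨0, by simp, by simp⟩
  | add f₁ f₂ _ _ h₁ h₂ =>
    obtain ⟨P₁, hP₁, h₁⟩ := h₁
    obtain ⟨P₂, hP₂, h₂⟩ := h₂
    exact ⟨P₁ + P₂, (totalDegree_add _ _).trans (max_le hP₁ hP₂), fun g => by simp [h₁, h₂]⟩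
  | smul a f _ h =>
    obtain ⟨P, hP, h⟩ := h
    exact ⟨a • P, (totalDegree_smul_le _ _).trans hP, fun g => by simp [h, smul_eval]⟩

/-! ### Plane rotations and averaging over `SO(d-1)` -/

/-- The rotation by the angle with cosine `v 0` and sine `v 1` in the plane framed by `U`. -/
noncomputable def planeRotation {d : ℕ} (U : Matrix (Fin d) (Fin 2) ℝ) (v : Fin 2 → ℝ) :
    Matrix (Fin d) (Fin d) ℝ :=
  (1 - U * U.transpose) + (v 0 • (U * U.transpose) +
    v 1 • (U * (!![0, -1; 1, 0] : Matrix (Fin 2) (Fin 2) ℝ) * U.transpose))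

theorem planeRotation_eq {d : ℕ} (U : Matrix (Fin d) (Fin 2) ℝ) (v : Fin 2 → ℝ) :
    planeRotation U v = 1 + U * ((!![v 0, -v 1; v 1, v 0] - 1) * U.transpose) := by
  have h : (!![v 0, -v 1; v 1, v 0] : Matrix (Fin 2) (Fin 2) ℝ) =
      v 0 • 1 + v 1 • !![0, -1; 1, 0] := by
    ext i j; fin_cases i <;> fin_cases j <;> simp
  rw [h, planeRotation]
  simp only [Matrix.sub_mul, Matrix.add_mul, Matrix.mul_sub, Matrix.mul_add, Matrix.smul_mul,
    Matrix.mul_smul, Matrix.one_mul, Matrix.mul_assoc]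
  abel

/-- Both conditions reduce to the 2 × 2 rotation block `K` through `UᵀU = 1`; the determinant does
so by `det (1 + AB) = det (1 + BA)`. -/
theorem planeRotation_mem {d : ℕ} {U : Matrix (Fin d) (Fin 2) ℝ} (hU : U.transpose * U = 1)
    {v : Fin 2 → ℝ} (hv : v 0 ^ 2 + v 1 ^ 2 = 1) :
    planeRotation U v ∈ Matrix.specialOrthogonalGroup (Fin d) ℝ := by
  rw [Matrix.mem_specialOrthogonalGroup_iff, Matrix.mem_orthogonalGroup_iff', planeRotation_eq]
  set K : Matrix (Fin 2) (Fin 2) ℝ := !![v 0, -v 1; v 1, v 0] with hK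
  have hKK : K.transpose * K = 1 := by
    ext i j
    fin_cases i <;> fin_cases j <;> simp [hK, Matrix.mul_apply, Fin.sum_univ_two] <;> linarith
  constructor
  · have h1 : (1 + U * ((K - 1) * U.transpose)).transpose =
        1 + U * ((K.transpose - 1) * U.transpose) := by
      simp [Matrix.mul_assoc]
    have h2 : U * ((K.transpose - 1) * U.transpose) * (U * ((K - 1) * U.transpose)) =
        U * (((K.transpose - 1) * (K - 1)) * U.transpose) := by
      calc _ = U * ((K.transpose - 1) * (U.transpose * U) * ((K - 1) * U.transpose)) := by
            simp only [Matrix.mul_assoc]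
        _ = _ := by rw [hU, Matrix.mul_one, Matrix.mul_assoc]
    have h3 : (K.transpose - 1) * (K - 1) = -(K.transpose - 1) - (K - 1) := by
      rw [Matrix.sub_mul, Matrix.mul_sub, hKK]
      simp
    rw [h1, add_mul, one_mul, mul_add, mul_one, h2, h3]
    simp only [Matrix.sub_mul, Matrix.neg_mul, Matrix.mul_sub, Matrix.mul_neg]
    abel
  · rw [Matrix.det_one_add_mul_comm, Matrix.mul_assoc, hU, Matrix.mul_one, add_sub_cancel, hK,
      Matrix.det_fin_two_of]
    linarith

theorem act_planeRotation {d : ℕ} {U : Matrix (Fin d) (Fin 2) ℝ} (hU : U.transpose * U = 1)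
    {v : Fin 2 → ℝ} (hv : v 0 ^ 2 + v 1 ^ 2 = 1) :
    act ⟨planeRotation U v, planeRotation_mem hU hv⟩ (framePoint U ![1, 0]) = framePoint U v := by
  have h : planeRotation U v * U = U * !![v 0, -v 1; v 1, v 0] := by
    rw [planeRotation_eq, Matrix.add_mul, Matrix.one_mul, Matrix.mul_assoc,
      Matrix.mul_assoc, hU, Matrix.mul_one,
      Matrix.mul_sub, Matrix.mul_one]
    abel
  simp only [act, framePoint, Matrix.mulVec_mulVec, h]
  rw [← Matrix.mulVec_mulVec]
  congr 2
  ext i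
  fin_cases i <;> simp

/-- Here `g'⁻¹ * g` lies in `SO(d-1)` and is absorbed by left invariance of Haar measure. Hence
`g_η` may be arbitrary, with no regularity in `η`. -/
theorem integral_SOsub_eq_of_act_lastVec_eq {d : ℕ} (F : SO d → ℂ) {g g' : SO d}
    (h : act g (lastVec d) = act g' (lastVec d)) :
    ∫ h : SOsub d, F (g * (h : SO d)) ∂(haarSOsub d) =
      ∫ h : SOsub d, F (g' * (h : SO d)) ∂(haarSOsub d) := by
  have hk : g'⁻¹ * g ∈ SOsub d := by
    change act (g'⁻¹ * g) (lastVec d) = lastVec d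
    rw [act_mul, h, ← act_mul, inv_mul_cancel, act_one]
  have : (haarSOsub d).IsMulLeftInvariant :=
    inferInstanceAs (Measure.haarMeasure ⊤).IsMulLeftInvariant
  rw [← integral_mul_left_eq_self (fun h : SOsub d => F (g' * (h : SO d))) ⟨_, hk⟩]
  simp [← mul_assoc]

theorem exists_integral_eval_entries_eq {d : ℕ} (P : MvPolynomial (Fin d × Fin d) ℂ)
    {U : Matrix (Fin d) (Fin 2) ℝ} (hU : U.transpose * U = 1) {g₀ : SO d}
    (hg₀ : act g₀ (lastVec d) = framePoint U ![1, 0]) :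
    ∃ Q : MvPolynomial (Fin 2) ℂ, Q.totalDegree ≤ P.totalDegree ∧
      ∀ (v : Fin 2 → ℝ) (g : SO d), v 0 ^ 2 + v 1 ^ 2 = 1 →
        act g (lastVec d) = framePoint U v →
          ∫ h : SOsub d, eval (entries (g * (h : SO d))) P ∂(haarSOsub d) =
            eval (fun i => (v i : ℂ)) Q := by
  let A : Option (Fin 2) → Matrix (Fin d) (Fin d) ℝ := fun k =>
    k.elim (1 - U * U.transpose) ![U * U.transpose,
      U * (!![0, -1; 1, 0] : Matrix (Fin 2) (Fin 2) ℝ) * U.transpose]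
  let w : SOsub d → (Fin d × Fin d) × Option (Fin 2) → ℂ := fun h ijk =>
    ((A ijk.2 * ((g₀ * h : SO d) : Matrix (Fin d) (Fin d) ℝ)) ijk.1.1 ijk.1.2 : ℝ)
  have hw : Continuous w := by
    refine continuous_pi fun ijk => Complex.continuous_ofReal.comp ?_
    have : Continuous fun h : SOsub d => ((g₀ * h : SO d) : Matrix (Fin d) (Fin d) ℝ) :=
      continuous_subtype_val.comp (continuous_const.mul continuous_subtype_val)
    exact (continuous_const.matrix_mul this).matrix_elem _ _
  have : IsFiniteMeasure (haarSOsub d) :=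
    ⟨isCompact_univ.measure_lt_top (μ := (Measure.haarMeasure ⊤ : Measure (SOsub d)))⟩
  obtain ⟨Q, hQ, h⟩ := exists_integral_eval_affine_eq (haarSOsub d) P w (fun _ => 1) fun q =>
    (((MvPolynomial.continuous_eval q).comp hw).mul
      continuous_const).integrable_of_hasCompactSupport (HasCompactSupport.of_compactSpace _)
  refine ⟨Q, hQ, fun v g hv hg => ?_⟩
  rw [← h, integral_SOsub_eq_of_act_lastVec_eq (fun g => eval (entries g) P)
    -- This representative moves `e^d` to the same point as `g` and has entries affine in `v`.
    (g' := ⟨planeRotation U v, planeRotation_mem hU hv⟩ * g₀)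
    (by rw [act_mul, hg₀, act_planeRotation hU hv, hg])]
  refine integral_congr_ae (Filter.Eventually.of_forall fun h => ?_)
  simp only [mul_one]
  congr 2
  funext ij
  have : ((⟨planeRotation U v, planeRotation_mem hU hv⟩ * g₀ * h : SO d) :
      Matrix (Fin d) (Fin d) ℝ) = A none * ((g₀ * h : SO d) : Matrix (Fin d) (Fin d) ℝ) +
      (v 0 • (A (some 0) * ((g₀ * h : SO d) : Matrix (Fin d) (Fin d) ℝ)) +
        v 1 • (A (some 1) * ((g₀ * h : SO d) : Matrix (Fin d) (Fin d) ℝ))) := by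
    rw [mul_assoc, ← Matrix.smul_mul, ← Matrix.smul_mul, ← Matrix.add_mul, ← Matrix.add_mul]
    rfl
  rw [entries, this, Fin.sum_univ_two]
  simp only [w, Matrix.add_apply, Matrix.smul_apply, smul_eq_mul]
  push_cast
  rfl

end RotationPoly

theorem lemma4 (d : ℕ) (hd : 3 ≤ d) (N₁ N₂ : ℕ)
    (f₁ f₂ : RotationPoly.SO d → ℂ)
    (hf₁ : f₁ ∈ RotationPoly.classOnePolys d N₁)
    (hf₂ : f₂ ∈ RotationPoly.classOnePolys d N₂)
    (γ : RotationPoly.Sph d → RotationPoly.SO d)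
    (hγ : ∀ η : RotationPoly.Sph d,
      RotationPoly.act (γ η) (RotationPoly.lastVec d) = (η : EuclideanSpace ℝ (Fin d))) :
    (fun η : RotationPoly.Sph d =>
      ∫ h : RotationPoly.SOsub d,
        f₁ (γ η * (h : RotationPoly.SO d)) * f₂ (γ η * (h : RotationPoly.SO d))
          ∂(RotationPoly.haarSOsub d)) ∈
      RotationPoly.sphericalPolys d (N₁ + N₂) := by
  obtain ⟨P₁, hP₁, h₁⟩ := RotationPoly.exists_eval_entries_of_mem_classOnePolys hf₁
  obtain ⟨P₂, hP₂, h₂⟩ := RotationPoly.exists_eval_entries_of_mem_classOnePolys hf₂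
  refine RotationPoly.mem_sphericalPolys_of_polynomial_on_circles (by omega) _ fun U hU => ?_
  have h0 : ‖RotationPoly.framePoint U ![1, 0]‖ = 1 := by
    have := RotationPoly.norm_framePoint_sq hU ![1, 0]
    have hn := norm_nonneg (RotationPoly.framePoint U ![1, 0])
    norm_num at this
    rcases this with h | h <;> linarith
  obtain ⟨Q, hQ, h⟩ := RotationPoly.exists_integral_eval_entries_eq (P₁ * P₂) hU
    (hγ ⟨RotationPoly.framePoint U ![1, 0], by simpa using h0⟩)
  refine ⟨Q, hQ.trans ((MvPolynomial.totalDegree_mul _ _).trans (add_le_add hP₁ hP₂)),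
    fun v η hη => ?_⟩
  have hn := RotationPoly.norm_framePoint_sq hU v
  rw [← hη, norm_eq_of_mem_sphere, one_pow] at hn
  rw [← h v (γ η) hn.symm ((hγ η).trans hη)]
  simp only [h₁, h₂, map_mul]
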